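/- Let $\mathbb K=\mathbb R$ or $\mathbb C$ and $I=(0,1]$. A function $x:I\to\mathbb K$ is moderate if there is $a\in\mathbb R$ with $\lim_{\varepsilon\to0}|x(\varepsilon)|/\varepsilon^{a}=0$, and null if this holds for every $a\in\mathbb R$. The moderate functions form a ring $\mathcal E_M(\mathbb K)$ under pointwise operations, in which the null functions form an ideal $\mathcal N(\mathbb K)$; let $\overline{\mathbb K}=\mathcal E_M(\mathbb K)/\mathcal N(\mathbb K)$ be the ring of Colombeau generalized numbers, and let $\overline{\mathbb H}=\mathbb H(\overline{\mathbb R})$ be the algebra of Colombeau generalized quaternions, i.e. the quaternion algebra over $\overline{\mathbb R}$ with basis $1,i,j,k$, where $i^2=j^2=-1$ and $ij=-ji=k$. For a ring $R$ with $1$: the right singular ideal $Z_r(R)$ is the set of all $x\in R$ whose right annihilator $\{r\in R: xr=0\}$ is an essential right ideal (i.e. meets every nonzero right ideal nontrivially). A right ideal $J$ of $R$ is dense if for all $x,y\in R$ with $x\neq0$ there is $r\in R$ with $xr\neq0$ and $yr\in J$. The maximal right ring of quotients $Q_{mr}(R)$ consists of the homomorphisms of right $R$-modules $f:J\to R$ defined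 on dense right ideals $J$ of $R$, two of them being identified if they agree on some dense right ideal contained in both domains; addition is pointwise on the intersection of the domains, and multiplication is composition, $fg$ being defined on $g^{-1}(\operatorname{dom} f)$. For commutative $R$ it is denoted $Q_{max}(R)$. A ring $Q$ is von Neumann regular if for every $a\in Q$ there is $b\in Q$ with $aba=a$. Then $Z_r(\overline{\mathbb K})=0$ and $Z_r(\overline{\mathbb H})=0$, and the rings $Q_{max}(\overline{\mathbb K})$ and $Q_{mr}(\overline{\mathbb H})$ are von Neumann regular. -/

import Mathlib

open Filter Topology
open scoped Quaternion

noncomputable section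

/-! ### Colombeau generalized numbers -/

namespace Colombeau

/-- The parameter interval `I = (0, 1]`. -/
abbrev Param : Type := Set.Ioc (0 : ℝ) 1

/-- The filter `ε → 0` on `I = (0, 1]`. -/
def toZero : Filter Param := comap (fun ε : Param => (ε : ℝ)) (𝓝 0)

/-- `lim_{ε → 0} |x(ε)| / ε ^ a = 0`. -/
def DecaysAtRate {𝕜 : Type*} [RCLike 𝕜] (x : Param → 𝕜) (a : ℝ) : Prop :=
  Tendsto (fun ε : Param => ‖x ε‖ / (ε : ℝ) ^ a) toZero (𝓝 0)

namespace DecaysAtRate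

variable {𝕜 : Type*} [RCLike 𝕜] {x y : Param → 𝕜} {a b : ℝ}

lemma zero (a : ℝ) : DecaysAtRate (0 : Param → 𝕜) a := by
  simpa [DecaysAtRate] using tendsto_const_nhds

lemma one : DecaysAtRate (1 : Param → 𝕜) (-1) := by
  have h : Tendsto (fun ε : Param => (ε : ℝ)) toZero (𝓝 0) := tendsto_comap
  refine h.congr fun ε => ?_
  simp [Real.rpow_neg_one]

lemma anti (h : DecaysAtRate x a) (hba : b ≤ a) : DecaysAtRate x b := by
  refine squeeze_zero (fun ε => ?_) (fun ε => ?_) h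
  · have := ε.2.1.le
    positivity
  · have h0 : (0 : ℝ) < (ε : ℝ) := ε.2.1
    exact div_le_div_of_nonneg_left (norm_nonneg _) (Real.rpow_pos_of_pos h0 _)
      (Real.rpow_le_rpow_of_exponent_ge h0 ε.2.2 hba)

lemma add (hx : DecaysAtRate x a) (hy : DecaysAtRate y a) : DecaysAtRate (x + y) a := by
  have h := Tendsto.add hx hy
  rw [add_zero] at h
  refine squeeze_zero (fun ε => ?_) (fun ε => ?_) h
  · have := ε.2.1.le
    positivity
  · have h0 : (0 : ℝ) < (ε : ℝ) := ε.2.1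
    rw [← add_div]
    exact div_le_div_of_nonneg_right (norm_add_le _ _) (Real.rpow_pos_of_pos h0 _).le

lemma neg (hx : DecaysAtRate x a) : DecaysAtRate (-x) a := by
  simpa [DecaysAtRate] using hx

lemma mul (hx : DecaysAtRate x a) (hy : DecaysAtRate y b) :
    DecaysAtRate (x * y) (a + b) := by
  have h := Tendsto.mul hx hy
  rw [mul_zero] at h
  refine h.congr fun ε => ?_
  have h0 : (0 : ℝ) < (ε : ℝ) := ε.2.1
  rw [Real.rpow_add h0, Pi.mul_apply, norm_mul, div_mul_div_comm]

end DecaysAtRate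

/-- The ring `ℰ_M(𝕜)` of moderate functions `I → 𝕜`. -/
def moderate (𝕜 : Type*) [RCLike 𝕜] : Subring (Param → 𝕜) where
  carrier := {x | ∃ a : ℝ, DecaysAtRate x a}
  zero_mem' := ⟨0, DecaysAtRate.zero 0⟩
  one_mem' := ⟨-1, DecaysAtRate.one⟩
  add_mem' := by
    rintro x y ⟨a, ha⟩ ⟨b, hb⟩
    exact ⟨min a b, (ha.anti (min_le_left a b)).add (hb.anti (min_le_right a b))⟩
  neg_mem' := by
    rintro x ⟨a, ha⟩
    exact ⟨a, ha.neg⟩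
  mul_mem' := by
    rintro x y ⟨a, ha⟩ ⟨b, hb⟩
    exact ⟨a + b, ha.mul hb⟩

/-- The ideal `𝒩(𝕜)` of null functions in `ℰ_M(𝕜)`. -/
def null (𝕜 : Type*) [RCLike 𝕜] : Ideal (moderate 𝕜) where
  carrier := {x | ∀ a : ℝ, DecaysAtRate (x : Param → 𝕜) a}
  zero_mem' := fun a => DecaysAtRate.zero a
  add_mem' := fun hx hy a => (hx a).add (hy a)
  smul_mem' := by
    rintro ⟨c, b, hb⟩ x hx a
    have h := hb.mul (hx (a - b))
    rw [add_sub_cancel] at h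
    exact h

/-- The ring of Colombeau generalized numbers `𝕜̄ = ℰ_M(𝕜) / 𝒩(𝕜)`. -/
abbrev GenNumber (𝕜 : Type*) [RCLike 𝕜] : Type _ := moderate 𝕜 ⧸ null 𝕜

/-- The Colombeau generalized quaternions: the quaternion algebra
(`i² = j² = -1`, `ij = -ji = k`) over the ring of generalized real numbers. -/
abbrev GenQuaternion : Type := ℍ[GenNumber ℝ]

end Colombeau

/-! ### Right ideals, the right singular ideal, von Neumann regularity -/

namespace RightQuotients

/-- Right ideals of `R`, i.e. submodules of `R` acted on by right multiplication. -/
abbrev RightIdeal (R : Type*) [Ring R] := Submodule Rᵐᵒᵖ R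

section

variable {R : Type*} [Ring R]

lemma RightIdeal.mul_mem {J : RightIdeal R} {x : R} (h : x ∈ J) (r : R) : x * r ∈ J := by
  simpa using J.smul_mem (MulOpposite.op r) h

/-- `J` is essential: it meets every nonzero right ideal nontrivially. -/
def IsEssential (J : RightIdeal R) : Prop :=
  ∀ K : RightIdeal R, K ≠ ⊥ → J ⊓ K ≠ ⊥

/-- `J` is dense: for all `x ≠ 0` and `y` there is `r` with `x r ≠ 0` and `y r ∈ J`. -/
def IsDense (J : RightIdeal R) : Prop :=
  ∀ x y : R, x ≠ 0 → ∃ r : R, x * r ≠ 0 ∧ y * r ∈ J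

/-- The right annihilator `{r | x r = 0}`. -/
def rightAnn (x : R) : RightIdeal R where
  carrier := {r | x * r = 0}
  zero_mem' := mul_zero x
  add_mem' := fun {a b} (ha : x * a = 0) (hb : x * b = 0) => by
    change x * (a + b) = 0
    rw [mul_add, ha, hb, add_zero]
  smul_mem' := fun c a (ha : x * a = 0) => by
    change x * (a * c.unop) = 0
    rw [← mul_assoc, ha, zero_mul]

lemma mem_rightAnn {x r : R} : r ∈ rightAnn x ↔ x * r = 0 := Iff.rfl

lemma isEssential_iff {J : RightIdeal R} :
    IsEssential J ↔ ∀ x : R, x ≠ 0 → ∃ r : R, x * r ≠ 0 ∧ x * r ∈ J := by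
  constructor
  · intro h x hx
    have hK : Submodule.span Rᵐᵒᵖ {x} ≠ ⊥ := by simpa using hx
    obtain ⟨y, hy, hy0⟩ := Submodule.exists_mem_ne_zero_of_ne_bot (h _ hK)
    obtain ⟨hyJ, hyK⟩ := Submodule.mem_inf.1 hy
    obtain ⟨c, rfl⟩ := Submodule.mem_span_singleton.1 hyK
    exact ⟨c.unop, hy0, hyJ⟩
  · intro h K hK
    obtain ⟨x, hxK, hx⟩ := Submodule.exists_mem_ne_zero_of_ne_bot hK
    obtain ⟨r, hr, hrJ⟩ := h x hx
    exact Submodule.ne_bot_iff _ |>.2 ⟨x * r, ⟨hrJ, RightIdeal.mul_mem hxK r⟩, hr⟩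

variable (R) in
/-- The right singular ideal `Z_r(R)`: all `x` whose right annihilator is an essential
right ideal. It is a two-sided ideal. -/
def rightSingularIdeal : TwoSidedIdeal R :=
  TwoSidedIdeal.mk' {x | IsEssential (rightAnn x)}
    (by
      refine isEssential_iff.2 fun x hx => ⟨1, by simpa using hx, ?_⟩
      simp [mem_rightAnn])
    (by
      intro x y hx hy
      have hx := isEssential_iff.1 hx
      have hy := isEssential_iff.1 hy
      refine isEssential_iff.2 fun z hz => ?_
      obtain ⟨r, hr, hr'⟩ := hx z hz
      obtain ⟨s, hs, hs'⟩ := hy _ hr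
      refine ⟨r * s, by rwa [← mul_assoc], ?_⟩
      rw [mem_rightAnn] at *
      rw [add_mul, ← mul_assoc z, hs', add_zero, ← mul_assoc, hr', zero_mul])
    (by
      intro x hx
      have hx := isEssential_iff.1 hx
      refine isEssential_iff.2 fun z hz => ?_
      obtain ⟨r, hr, hr'⟩ := hx z hz
      refine ⟨r, hr, ?_⟩
      rw [mem_rightAnn] at *
      rw [neg_mul, hr', neg_zero])
    (by
      intro x y hy
      have hy := isEssential_iff.1 hy
      refine isEssential_iff.2 fun z hz => ?_
      obtain ⟨r, hr, hr'⟩ := hy z hz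
      refine ⟨r, hr, ?_⟩
      rw [mem_rightAnn] at *
      rw [mul_assoc, hr', mul_zero])
    (by
      intro x y hx
      have hx := isEssential_iff.1 hx
      refine isEssential_iff.2 fun z hz => ?_
      by_cases hyz : y * z = 0
      · exact ⟨1, by simpa using hz, by simp [mem_rightAnn, mul_assoc, hyz]⟩
      · obtain ⟨r, hr, hr'⟩ := hx _ hyz
        refine ⟨r, fun h => hr (by rw [mul_assoc, h, mul_zero]), ?_⟩
        rw [mem_rightAnn] at *
        rw [← hr']
        simp only [mul_assoc])

lemma mem_rightSingularIdeal {x : R} :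
    x ∈ rightSingularIdeal R ↔ IsEssential (rightAnn x) := by
  unfold rightSingularIdeal
  exact TwoSidedIdeal.mem_mk' ..

end

/-- `R` is von Neumann regular: every `a` is of the form `a b a`. -/
def IsVonNeumannRegular (R : Type*) [Ring R] : Prop :=
  ∀ a : R, ∃ b : R, a * b * a = a

/-! ### The maximal right ring of quotients -/

section

variable {R : Type*} [Ring R]

lemma IsDense.top : IsDense (⊤ : RightIdeal R) :=
  fun x _ hx => ⟨1, by simpa using hx, Submodule.mem_top⟩

lemma IsDense.inf {J K : RightIdeal R} (hJ : IsDense J) (hK : IsDense K) :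
    IsDense (J ⊓ K) := by
  intro x y hx
  obtain ⟨r, hr, hr'⟩ := hJ x y hx
  obtain ⟨s, hs, hs'⟩ := hK (x * r) (y * r) hr
  rw [mul_assoc] at hs hs'
  exact ⟨r * s, hs, by rw [← mul_assoc]; exact RightIdeal.mul_mem hr' s, hs'⟩

variable (R) in
/-- A homomorphism of right `R`-modules `J → R` defined on a dense right ideal `J`. -/
structure DenseHom where
  domain : RightIdeal R
  dense : IsDense domain
  toFun : domain →ₗ[Rᵐᵒᵖ] R

namespace DenseHom

/-- The right ideal `{x ∈ J | f x ∈ K}`, where `f : J → R`. -/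
def preimage (f : DenseHom R) (K : RightIdeal R) : RightIdeal R :=
  (K.comap f.toFun).map f.domain.subtype

lemma mem_preimage {f : DenseHom R} {K : RightIdeal R} {x : R} :
    x ∈ f.preimage K ↔ ∃ h : x ∈ f.domain, f.toFun ⟨x, h⟩ ∈ K := by
  simp [preimage]

lemma preimage_le (f : DenseHom R) (K : RightIdeal R) : f.preimage K ≤ f.domain :=
  fun _ hx => (mem_preimage.1 hx).1

lemma isDense_preimage (f : DenseHom R) {K : RightIdeal R} (hK : IsDense K) :
    IsDense (f.preimage K) := by
  intro x y hx
  obtain ⟨r, hr, hr'⟩ := f.dense x y hx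
  obtain ⟨s, hs, hs'⟩ := hK (x * r) (f.toFun ⟨y * r, hr'⟩) hr
  rw [mul_assoc] at hs
  refine ⟨r * s, hs, mem_preimage.2 ⟨?_, ?_⟩⟩
  · rw [← mul_assoc]
    exact RightIdeal.mul_mem hr' s
  · have h := f.toFun.map_smul (MulOpposite.op s) ⟨y * r, hr'⟩
    rw [op_smul_eq_mul] at h
    rw [← h] at hs'
    convert hs' using 3
    simp [mul_assoc]

/-- `f` and `g` agree on some dense right ideal contained in both domains. -/
def Equivalent (f g : DenseHom R) : Prop :=
  ∃ L : RightIdeal R, IsDense L ∧ ∃ (hf : L ≤ f.domain) (hg : L ≤ g.domain),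
    ∀ x (hx : x ∈ L), f.toFun ⟨x, hf hx⟩ = g.toFun ⟨x, hg hx⟩

variable (R) in
/-- Agreement on a dense right ideal is an equivalence relation. -/
instance setoid : Setoid (DenseHom R) where
  r := Equivalent
  iseqv :=
    { refl := fun f => ⟨f.domain, f.dense, le_rfl, le_rfl, fun _ _ => rfl⟩
      symm := fun ⟨L, hL, hf, hg, h⟩ => ⟨L, hL, hg, hf, fun x hx => (h x hx).symm⟩
      trans := fun ⟨L, hL, hf, _, h⟩ ⟨M, hM, _, hk, h'⟩ =>
        ⟨L ⊓ M, hL.inf hM, inf_le_left.trans hf, inf_le_right.trans hk,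
          fun x hx => (h x hx.1).trans (h' x hx.2)⟩ }

lemma equiv_of {f g : DenseHom R} {L : RightIdeal R} (hL : IsDense L)
    (hf : L ≤ f.domain) (hg : L ≤ g.domain)
    (h : ∀ x (hx : x ∈ L), f.toFun ⟨x, hf hx⟩ = g.toFun ⟨x, hg hx⟩) : f ≈ g :=
  ⟨L, hL, hf, hg, h⟩

instance : Zero (DenseHom R) := ⟨⟨⊤, IsDense.top, 0⟩⟩

instance : One (DenseHom R) := ⟨⟨⊤, IsDense.top, Submodule.subtype _⟩⟩

instance : Neg (DenseHom R) := ⟨fun f => ⟨f.domain, f.dense, -f.toFun⟩⟩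

/-- The sum, defined on the intersection of the domains. -/
instance : Add (DenseHom R) :=
  ⟨fun f g => ⟨f.domain ⊓ g.domain, f.dense.inf g.dense,
    f.toFun.comp (Submodule.inclusion inf_le_left) +
      g.toFun.comp (Submodule.inclusion inf_le_right)⟩⟩

/-- The composite `f ∘ g`, defined on the preimage under `g` of the domain of `f`. -/
instance : Mul (DenseHom R) :=
  ⟨fun f g => ⟨g.preimage f.domain, g.isDense_preimage f.dense,
    f.toFun.comp ((g.toFun.comp (Submodule.inclusion (g.preimage_le f.domain))).codRestrict
      f.domain fun x => (mem_preimage.1 x.2).2)⟩⟩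

lemma add_toFun (f g : DenseHom R) (x : R) (h : x ∈ (f + g).domain) :
    (f + g).toFun ⟨x, h⟩ = f.toFun ⟨x, h.1⟩ + g.toFun ⟨x, h.2⟩ := rfl

lemma neg_toFun (f : DenseHom R) (x : R) (h : x ∈ (-f).domain) :
    (-f).toFun ⟨x, h⟩ = -f.toFun ⟨x, h⟩ := rfl

lemma zero_toFun (x : R) (h : x ∈ (0 : DenseHom R).domain) :
    (0 : DenseHom R).toFun ⟨x, h⟩ = 0 := rfl

lemma one_toFun (x : R) (h : x ∈ (1 : DenseHom R).domain) :
    (1 : DenseHom R).toFun ⟨x, h⟩ = x := rfl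

lemma mem_mul_domain {f g : DenseHom R} {x : R} :
    x ∈ (f * g).domain ↔ ∃ h : x ∈ g.domain, g.toFun ⟨x, h⟩ ∈ f.domain := mem_preimage

lemma mul_toFun (f g : DenseHom R) (x : R) (h : x ∈ (f * g).domain) :
    (f * g).toFun ⟨x, h⟩ =
      f.toFun ⟨g.toFun ⟨x, (mem_mul_domain.1 h).1⟩, (mem_mul_domain.1 h).2⟩ := rfl

lemma add_congr {f f' g g' : DenseHom R} (h : f ≈ f') (k : g ≈ g') : f + g ≈ f' + g' := by
  obtain ⟨L, hL, h1, h2, h⟩ := h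
  obtain ⟨M, hM, k1, k2, k⟩ := k
  refine equiv_of (hL.inf hM) (inf_le_inf h1 k1) (inf_le_inf h2 k2) fun x hx => ?_
  rw [add_toFun, add_toFun, h x hx.1, k x hx.2]

lemma neg_congr {f f' : DenseHom R} (h : f ≈ f') : -f ≈ -f' := by
  obtain ⟨L, hL, h1, h2, h⟩ := h
  refine equiv_of hL h1 h2 fun x hx => ?_
  rw [neg_toFun, neg_toFun, h x hx]

lemma mul_congr {f f' g g' : DenseHom R} (h : f ≈ f') (k : g ≈ g') : f * g ≈ f' * g' := by
  obtain ⟨L, hL, h1, h2, h⟩ := h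
  obtain ⟨M, hM, k1, k2, k⟩ := k
  have key : ∀ x, x ∈ M ⊓ g.preimage L → ∃ (a : x ∈ g.domain) (b : x ∈ g'.domain),
      g.toFun ⟨x, a⟩ = g'.toFun ⟨x, b⟩ ∧ g.toFun ⟨x, a⟩ ∈ L := by
    rintro x ⟨hx, hx'⟩
    obtain ⟨a, ha⟩ := mem_preimage.1 hx'
    exact ⟨a, k2 hx, k x hx, ha⟩
  refine equiv_of (hM.inf (g.isDense_preimage hL)) (fun x hx => ?_) (fun x hx => ?_)
    fun x hx => ?_
  · obtain ⟨a, b, e, m⟩ := key x hx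
    exact mem_mul_domain.2 ⟨a, h1 m⟩
  · obtain ⟨a, b, e, m⟩ := key x hx
    exact mem_mul_domain.2 ⟨b, h2 (e ▸ m)⟩
  · obtain ⟨a, b, e, m⟩ := key x hx
    rw [mul_toFun, mul_toFun, h _ m]
    congr 2

end DenseHom

variable (R) in
/-- The maximal right ring of quotients `Q_mr(R)`: homomorphisms of right `R`-modules `J → R`
on dense right ideals `J`, up to agreement on a dense right ideal. Addition is pointwise and
multiplication is composition. -/
def MaxRightQuotientRing : Type _ := Quotient (DenseHom.setoid R)

namespace MaxRightQuotientRing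

open DenseHom

instance : Zero (MaxRightQuotientRing R) := ⟨Quotient.mk _ 0⟩

instance : One (MaxRightQuotientRing R) := ⟨Quotient.mk _ 1⟩

instance : Neg (MaxRightQuotientRing R) :=
  ⟨Quotient.map (fun f => -f) fun _ _ h => neg_congr h⟩

instance : Add (MaxRightQuotientRing R) :=
  ⟨Quotient.map₂ (fun f g => f + g) fun _ _ h _ _ k => add_congr h k⟩

instance : Mul (MaxRightQuotientRing R) :=
  ⟨Quotient.map₂ (fun f g => f * g) fun _ _ h _ _ k => mul_congr h k⟩

/-- Any two representatives that agree wherever both are defined give the same element. -/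
lemma mk_eq {f g : DenseHom R}
    (h : ∀ x (hf : x ∈ f.domain) (hg : x ∈ g.domain), f.toFun ⟨x, hf⟩ = g.toFun ⟨x, hg⟩) :
    (Quotient.mk _ f : MaxRightQuotientRing R) = Quotient.mk _ g :=
  Quotient.sound (equiv_of (f.dense.inf g.dense) inf_le_left inf_le_right
    fun x hx => h x hx.1 hx.2)

instance : Ring (MaxRightQuotientRing R) where
  add_assoc := by
    rintro ⟨f⟩ ⟨g⟩ ⟨k⟩
    exact mk_eq fun x _ _ => by simp only [add_toFun, add_assoc]
  zero_add := by
    rintro ⟨f⟩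
    exact mk_eq fun x _ _ => by simp only [add_toFun, zero_toFun, zero_add]
  add_zero := by
    rintro ⟨f⟩
    exact mk_eq fun x _ _ => by simp only [add_toFun, zero_toFun, add_zero]
  add_comm := by
    rintro ⟨f⟩ ⟨g⟩
    exact mk_eq fun x _ _ => by simp only [add_toFun, add_comm]
  neg_add_cancel := by
    rintro ⟨f⟩
    exact mk_eq fun x _ _ => by simp only [add_toFun, neg_toFun, zero_toFun, neg_add_cancel]
  left_distrib := by
    rintro ⟨f⟩ ⟨g⟩ ⟨k⟩
    refine mk_eq fun x hx hx' => ?_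
    have hg := (mem_mul_domain.1 hx'.1).2
    have hk := (mem_mul_domain.1 hx'.2).2
    simp only [add_toFun, mul_toFun]
    exact f.toFun.map_add ⟨_, hg⟩ ⟨_, hk⟩
  right_distrib := by
    rintro ⟨f⟩ ⟨g⟩ ⟨k⟩
    exact mk_eq fun x _ _ => by simp only [add_toFun, mul_toFun]
  zero_mul := by
    rintro ⟨f⟩
    exact mk_eq fun x _ _ => by simp only [mul_toFun, zero_toFun]
  mul_zero := by
    rintro ⟨f⟩
    exact mk_eq fun x _ _ => by
      simp only [mul_toFun, zero_toFun]
      exact f.toFun.map_zero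
  mul_assoc := by
    rintro ⟨f⟩ ⟨g⟩ ⟨k⟩
    exact mk_eq fun x _ _ => by simp only [mul_toFun]
  one_mul := by
    rintro ⟨f⟩
    exact mk_eq fun x _ _ => by simp only [mul_toFun, one_toFun]
  mul_one := by
    rintro ⟨f⟩
    exact mk_eq fun x _ _ => by simp only [mul_toFun, one_toFun]
  nsmul := nsmulRec
  zsmul := zsmulRec

end MaxRightQuotientRing

end

end RightQuotients

end

/-!
The two halves of the statement come from one property of `𝕜̄` and `ℍ̄`: neither ring has nonzero
nilpotents.

* For generalized numbers, a function whose square is bounded by a null function is null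
  (`DecaysAtRate.of_sq_norm_le`). So `𝕜̄` is reduced, and a vanishing sum of squares in `ℝ̄` has
  vanishing terms. By the second fact, a generalized quaternion of norm zero is zero, and since
  the norm is multiplicative, `ℍ̄` is reduced as well.
* In a reduced ring, an `x` with essential right annihilator is zero: if `x r ≠ 0` and
  `x (x r) = 0`, then `x r x` squares to zero, hence so does `x r`.
* If `Z_r(R) = 0`, then essential right ideals are dense (`IsEssential.isDense`), and `Q_mr(R)` is
  von Neumann regular by Johnson's argument: given `f : J → R`, take `L ≤ J` such that
  `ker f ⊕ L` is essential in `J`, and let `g` invert `f` on `f(L)` and vanish on a right ideal `M`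
  for which `f(L) ⊕ M` is essential. Then `f g f = f` on the dense right ideal `ker f ⊕ L`.
-/

namespace RightQuotients

/-! ### Rings with zero right singular ideal -/

section

variable {R : Type*} [Ring R]

theorem rightSingularIdeal_eq_bot_of_isReduced [IsReduced R] :
    rightSingularIdeal R = ⊥ := by
  refine le_bot_iff.1 fun x hx => ?_
  rw [TwoSidedIdeal.mem_bot]
  by_contra hx0
  obtain ⟨r, hr, hr'⟩ := isEssential_iff.1 (mem_rightSingularIdeal.1 hx) x hx0
  rw [mem_rightAnn] at hr'
  have h1 : x * r * x = 0 := by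
    refine eq_zero_of_pow_eq_zero (n := 2) ?_
    calc (x * r * x) ^ 2 = x * r * (x * (x * r)) * x := by noncomm_ring
      _ = 0 := by rw [hr', mul_zero, zero_mul]
  refine hr (eq_zero_of_pow_eq_zero (n := 2) ?_)
  rw [sq, ← mul_assoc, h1, zero_mul]

/-- In a right nonsingular ring, essential right ideals are dense. If `x r = 0` whenever
`y r ∈ J`, then the right annihilator of `x` contains the essential right ideal
`{r | y r ∈ J}`. -/
theorem IsEssential.isDense (hR : rightSingularIdeal R = ⊥) {J : RightIdeal R}
    (hJ : IsEssential J) : IsDense J := by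
  intro x y hx
  by_contra! hxy
  refine hx ((TwoSidedIdeal.mem_bot R).1 (hR ▸ mem_rightSingularIdeal.2 ?_))
  refine isEssential_iff.2 fun z hz => ?_
  by_cases hyz : y * z = 0
  · refine ⟨1, by simpa using hz, ?_⟩
    by_contra h
    exact hxy (z * 1) h (by simp [hyz])
  · obtain ⟨r, hr, hr'⟩ := isEssential_iff.1 hJ _ hyz
    rw [mul_assoc] at hr hr'
    refine ⟨r, fun h => hr (by rw [h, mul_zero]), ?_⟩
    by_contra h
    exact hxy (z * r) h hr'

/-- Every right ideal is a direct summand of an essential right ideal: its complement is a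
right ideal maximal among those meeting it trivially. -/
theorem exists_disjoint_isEssential_sup (K : RightIdeal R) :
    ∃ L : RightIdeal R, Disjoint K L ∧ IsEssential (K ⊔ L) := by
  obtain ⟨L, hL⟩ := zorn_le₀ {L : RightIdeal R | Disjoint K L} fun c hc hchain =>
    ⟨sSup c, hchain.directedOn.disjoint_sSup_right.2 fun L hL => hc hL, fun L hL => le_sSup hL⟩
  refine ⟨L, hL.prop, fun N hN hKN => hN ?_⟩
  have h : Disjoint K (L ⊔ N) :=
    Disjoint.disjoint_sup_right_of_disjoint_sup_left hL.prop (disjoint_iff.2 hKN)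
  have hNL : N ≤ L := le_sup_right.trans (hL.le_of_ge h le_sup_left)
  exact le_bot_iff.1 (hKN ▸ le_inf (hNL.trans le_sup_right) le_rfl)

/-! ### Regularity of the maximal right ring of quotients -/

/-- A generalized inverse of a partial homomorphism `f`: it is the inverse of `f` on the image
of a complement of `ker f`, and zero on a complement of that image. -/
theorem DenseHom.exists_generalized_inverse (hR : rightSingularIdeal R = ⊥) (f : DenseHom R) :
    ∃ (g : DenseHom R) (D : RightIdeal R), IsDense D ∧ D ≤ f.domain ∧
      ∀ x (hx : x ∈ f.domain), x ∈ D →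
        ∃ (h : f.toFun ⟨x, hx⟩ ∈ g.domain) (h' : g.toFun ⟨_, h⟩ ∈ f.domain),
          f.toFun ⟨_, h'⟩ = f.toFun ⟨x, hx⟩ := by
  obtain ⟨L, hKL, hD⟩ := exists_disjoint_isEssential_sup (f.preimage ⊥)
  let F : R →ₗ.[Rᵐᵒᵖ] R :=
    ⟨L ⊓ f.domain, f.toFun.comp (Submodule.inclusion inf_le_right)⟩
  have hF : F.toFun.ker = ⊥ := by
    refine LinearMap.ker_eq_bot'.2 fun x hx => ?_
    refine Subtype.ext (Submodule.disjoint_def.1 hKL x ?_ x.2.1)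
    exact mem_preimage.2 ⟨x.2.2, hx⟩
  obtain ⟨M, hM, hFM⟩ := exists_disjoint_isEssential_sup F.inverse.domain
  let G : R →ₗ.[Rᵐᵒᵖ] R :=
    F.inverse.sup ⟨M, 0⟩ (LinearPMap.sup_h_of_disjoint F.inverse ⟨M, 0⟩ hM)
  have hG : ∀ l (hl : l ∈ L) (hf : l ∈ f.domain),
      ∃ h : f.toFun ⟨l, hf⟩ ∈ G.domain, G.toFun ⟨_, h⟩ = l := by
    intro l hl hf
    have h1 : f.toFun ⟨l, hf⟩ ∈ F.inverse.domain := by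
      rw [LinearPMap.inverse_domain]
      exact ⟨⟨l, hl, hf⟩, rfl⟩
    have hle : F.inverse ≤ G := LinearPMap.left_le_sup _ _ _
    refine ⟨hle.1 h1, ?_⟩
    have h2 := hle.2 (x := ⟨_, h1⟩) (y := ⟨_, hle.1 h1⟩) rfl
    refine h2.symm.trans ?_
    exact LinearPMap.inverse_apply_eq hF (x := ⟨l, hl, hf⟩) rfl
  refine ⟨⟨G.domain, hFM.isDense hR, G.toFun⟩, (f.preimage ⊥ ⊔ L) ⊓ f.domain,
    (hD.isDense hR).inf f.dense, inf_le_right, ?_⟩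
  rintro x hx ⟨hxD, -⟩
  obtain ⟨k, hk, l, hl, rfl⟩ := Submodule.mem_sup.1 hxD
  obtain ⟨hk1, hk2⟩ := mem_preimage.1 hk
  have hlf : l ∈ f.domain := by simpa using f.domain.sub_mem hx hk1
  have e : f.toFun ⟨k + l, hx⟩ = f.toFun ⟨l, hlf⟩ := by
    have := f.toFun.map_add ⟨k, hk1⟩ ⟨l, hlf⟩
    rw [(Submodule.mem_bot _).1 hk2, zero_add] at this
    exact this
  obtain ⟨h, h'⟩ := hG l hl hlf
  simp only [e]
  refine ⟨h, ?_⟩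
  simp only [h', exists_prop, and_true]
  exact hlf

theorem isVonNeumannRegular_maxRightQuotientRing (hR : rightSingularIdeal R = ⊥) :
    IsVonNeumannRegular (MaxRightQuotientRing R) := by
  rintro ⟨f⟩
  obtain ⟨g, D, hD, hDf, h⟩ := f.exists_generalized_inverse hR
  refine ⟨Quotient.mk _ g, Quotient.sound (DenseHom.equiv_of (f := f * g * f) hD
    (fun x hx => ?_) hDf fun x hx => ?_)⟩
  · obtain ⟨h1, h2, -⟩ := h x (hDf hx) hx
    exact DenseHom.mem_mul_domain.2 ⟨hDf hx, DenseHom.mem_mul_domain.2 ⟨h1, h2⟩⟩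
  · obtain ⟨h1, h2, h3⟩ := h x (hDf hx) hx
    exact h3

end

end RightQuotients

namespace Colombeau

/-! ### Generalized numbers and quaternions are reduced -/

lemma DecaysAtRate.of_sq_norm_le {𝕜 : Type*} [RCLike 𝕜] {x y : Param → 𝕜} {a : ℝ}
    (hy : DecaysAtRate y (2 * a)) (h : ∀ ε, ‖x ε‖ ^ 2 ≤ ‖y ε‖) : DecaysAtRate x a := by
  have hsq : Tendsto (fun ε : Param => (‖x ε‖ / (ε : ℝ) ^ a) ^ 2) toZero (𝓝 0) := by
    refine squeeze_zero (fun ε => sq_nonneg _) (fun ε => ?_) hy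
    have h0 : (0 : ℝ) < (ε : ℝ) := ε.2.1
    rw [div_pow, ← Real.rpow_mul_natCast h0.le, mul_comm a]
    exact div_le_div_of_nonneg_right (h ε) (Real.rpow_pos_of_pos h0 _).le
  have h1 := hsq.sqrt
  rw [Real.sqrt_zero] at h1
  refine h1.congr fun ε => Real.sqrt_sq ?_
  have := ε.2.1.le
  positivity

instance (𝕜 : Type*) [RCLike 𝕜] : IsReduced (GenNumber 𝕜) := by
  refine (isReduced_iff_pow_one_lt 2 one_lt_two).2 fun x hx => ?_
  obtain ⟨x, rfl⟩ := Ideal.Quotient.mk_surjective x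
  rw [← map_pow, Ideal.Quotient.eq_zero_iff_mem] at hx
  refine Ideal.Quotient.eq_zero_iff_mem.2 fun a => (hx (2 * a)).of_sq_norm_le fun ε => ?_
  simp

/-- On representatives, each real square is bounded pointwise by the sum of all of them, so each
is null as soon as the sum is. -/
lemma GenNumber.eq_zero_of_sum_sq_eq_zero {ι : Type*} [Fintype ι] {x : ι → GenNumber ℝ}
    (h : ∑ i, x i ^ 2 = 0) (i : ι) : x i = 0 := by
  choose u hu using fun i => Ideal.Quotient.mk_surjective (x i)
  simp only [← hu, ← map_pow, ← map_sum, Ideal.Quotient.eq_zero_iff_mem] at h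
  rw [← hu, Ideal.Quotient.eq_zero_iff_mem]
  refine fun a => (h (2 * a)).of_sq_norm_le fun ε => ?_
  have hle : (u i).1 ε ^ 2 ≤ |∑ j, (u j).1 ε ^ 2| :=
    (Finset.single_le_sum (f := fun j => (u j).1 ε ^ 2) (fun j _ => sq_nonneg _)
      (Finset.mem_univ i)).trans (le_abs_self _)
  simpa using hle

lemma GenQuaternion.eq_zero_of_normSq_eq_zero {q : GenQuaternion}
    (h : Quaternion.normSq q = 0) : q = 0 := by
  have h0 := GenNumber.eq_zero_of_sum_sq_eq_zero (x := ![q.1, q.2, q.3, q.4])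
    (by simpa [Fin.sum_univ_four, Quaternion.normSq_def'] using h)
  exact QuaternionAlgebra.ext (h0 0) (h0 1) (h0 2) (h0 3)

instance : IsReduced GenQuaternion := by
  refine (isReduced_iff_pow_one_lt (R := GenQuaternion) 2 one_lt_two).2 fun q hq => ?_
  refine GenQuaternion.eq_zero_of_normSq_eq_zero (eq_zero_of_pow_eq_zero (n := 2) ?_)
  rw [← map_pow, hq, map_zero]

end Colombeau

theorem mainTheorem7 (𝕜 : Type*) [RCLike 𝕜] :
    (RightQuotients.rightSingularIdeal (Colombeau.GenNumber 𝕜) = ⊥ ∧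
      RightQuotients.rightSingularIdeal Colombeau.GenQuaternion = ⊥) ∧
    (RightQuotients.IsVonNeumannRegular
        (RightQuotients.MaxRightQuotientRing (Colombeau.GenNumber 𝕜)) ∧
      RightQuotients.IsVonNeumannRegular
        (RightQuotients.MaxRightQuotientRing Colombeau.GenQuaternion)) := by
  have h𝕜 := RightQuotients.rightSingularIdeal_eq_bot_of_isReduced
    (R := Colombeau.GenNumber 𝕜)
  have hℍ := RightQuotients.rightSingularIdeal_eq_bot_of_isReduced
    (R := Colombeau.GenQuaternion)
  exact ⟨⟨h𝕜, hℍ⟩, RightQuotients.isVonNeumannRegular_maxRightQuotientRing h𝕜,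
    RightQuotients.isVonNeumannRegular_maxRightQuotientRing hℍ⟩
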